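/- **Graphs.** Let $\mathbb{A}$ be a set of edge labels with arities, and let $\mathbb{A}^{\mathfrak d}=\mathbb{A}\cup\{\mathfrak d\}$ with a further binary label $\mathfrak d$. A c-graph $G$ (of type $0$) consists of finite sets $V_G$ of vertices and $E_G$ of edges, where each edge $e$ has a label $\mathrm{lab}_G(e)$ and a sequence $\mathrm{edg}_G(e)$ of attached vertices, whose length is the arity of the label. It is simple if distinct edges with the same label have different sequences of attached vertices. $G|_{\mathbb{A}}$ is obtained from $G$ by deleting all $\mathfrak d$-labelled edges. The tree-width $\mathrm{tw}(G)$ is the least width of a tree decomposition of $G$ (a finite tree with bags of vertices, such that the vertices attached to an edge are together in some bag and the nodes whose bags contain a given vertex form a non-empty connected set; the width is the maximal bag size minus one, or $0$ if all bags are empty). For a set $\mathcal G$ of c-graphs, $\mathrm{tw}(\mathcal G)=\sup_{G\in\mathcal G}\mathrm{tw}(G)\in\mathbb{N}\cup\{\infty\}$. **Fusion bound.** Let $G$ be a c-graph over $\mathbb{A}^{\mathfrak d}$. An equivalence relation $\approx$ on $V_G$ is compatible with $G$ if (1) no two distinct edges with the same label in $\mathbb{A}$ have componentwise $\approx$-equivalent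 sequences of attached vertices, and (2) $v_1\not\approx v_2$ for each $\mathfrak d$-labelled edge attached to $\langle v_1,v_2\rangle$. The quotient $G_{/\approx}$ has the $\approx$-classes as vertices, and the edges and labels of $G$, attached to the classes of the vertices to which they were attached. The relation $\approx$ is $k$-generated if $k$ is the least cardinality of a set of pairs such that $\approx$ is the least equivalence relation containing it. The fusion bound $\mathrm{fb}(G)$ is the maximal $k$ such that some equivalence relation compatible with $G$ is $k$-generated, and $\mathrm{fb}(\mathcal G)=\sup_{G\in\mathcal G}\mathrm{fb}(G)\in\mathbb{N}\cup\{\infty\}$. **Logic.** A qpf formula is a separating conjunction of atoms $x=y$, $x\neq y$ and $\mathsf r(x_1,\ldots,x_n)$, with $\mathsf r\in\mathbb{A}$ of arity $n$. A SID $\Delta$ is a set of rules $\mathsf B_0(x_1,\ldots,x_n)\leftarrow\exists y_1\ldots\exists y_m\,.\,\psi * \mathsf B_1(\mathbf z_1)*\cdots*\mathsf B_k(\mathbf z_k)$, where $\psi$ is a qpf formula, the $\mathsf B_i$ are predicates, and all variables are among the $x_i$ and $y_j$. An atom $x=y$ (resp. $x\neq y$) holds under a store (assignment of vertices to variables) $\mathfrak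 s$ in a c-graph without edges if $\mathfrak s(x)=\mathfrak s(y)$ (resp. $\mathfrak s(x)\neq\mathfrak s(y)$), the atom $\mathsf r(x_1,\ldots,x_n)$ holds in a c-graph whose only edge is labelled by $\mathsf r$ and attached to $\langle\mathfrak s(x_1),\ldots,\mathfrak s(x_n)\rangle$, and a separating conjunction holds in a simple c-graph if its edges can be split into disjoint parts, one for each conjunct, in which the conjuncts hold (vertices may be shared). A predicate atom holds if the right-hand side of some rule for the predicate, instantiated with its arguments, holds for some values of the existential variables (least such interpretation). In all models the vertices are exactly the values of the variables of the formula, resp. of the unfolding. For a nullary predicate $\mathsf A$, let $[\![\mathsf A]\!]_\Delta$ be the set of simple c-graphs over $\mathbb{A}$ that satisfy $\mathsf A$. **Rich canonical models.** A parse tree $T$ for $\mathsf A$ is a tree of rules of $\Delta$ that describes a complete unfolding of $\mathsf A$; its characteristic formula $\Theta(T)$ is the qpf formula that is the separating conjunction of all atoms $x=y$, $x\ne y$, $\mathsf r(\ldots)$ of the unfolding, with a fresh copy of the existential variables of a rule for each of its occurrences and with the formal parameters replaced by the actual ones. A store $\mathfrak s$ is canonical for $\Theta(T)$ if $\mathfrak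 s(x)=\mathfrak s(y)$ only if $x=y$ is a logical consequence of $\Theta(T)$, for all variables $x,y$. A rich canonical $\Delta$-model of $\mathsf A$ is a simple c-graph $G$ over $\mathbb{A}^{\mathfrak d}$ for which there are a parse tree $T$ for $\mathsf A$ and a store $\mathfrak s$ canonical for $\Theta(T)$ such that $G|_{\mathbb{A}}$ satisfies $\Theta(T)$ under $\mathfrak s$ and, for all $u,v\in V_G$, there is a $\mathfrak d$-labelled edge attached to $\langle u,v\rangle$ iff $x\neq y$ occurs in $\Theta(T)$ for some variables $x,y$ with $\mathfrak s(x)=u$ and $\mathfrak s(y)=v$. Let $[\![\mathsf A]\!]^{rc}_\Delta$ be the set of these. **Statement.** For each SID $\Delta$ and nullary predicate $\mathsf A$: $$\mathrm{tw}([\![\mathsf A]\!]_\Delta)\;\le\;\mathrm{tw}([\![\mathsf A]\!]^{rc}_\Delta)+\mathrm{fb}([\![\mathsf A]\!]^{rc}_\Delta).$$ Moreover, for each c-graph $G$ over $\mathbb{A}^{\mathfrak d}$ and each $k$-generated equivalence relation $\approx$ compatible with $G$, we have $\mathrm{tw}(G_{/\approx})\le\mathrm{tw}(G)+k$. -/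

import Mathlib

namespace SLR

/-! ### Concrete graphs -/

/-- A finite concrete graph (c-graph) of type 0, i.e., without sources, over the set `L` of edge
labels with arities `ar`.  Each edge is attached to a sequence of vertices, whose length is the
arity of the label of the edge. -/
structure CGraph {L : Type*} (ar : L → ℕ) where
  V : Type
  E : Type
  finV : Finite V
  finE : Finite E
  lab : E → L
  edg : E → List V
  edg_length : ∀ e, (edg e).length = ar (lab e)

attribute [instance] CGraph.finV CGraph.finE

/-- No two distinct edges have the same label and the same sequence of vertices. -/
def CGraph.Simple {L : Type*} {ar : L → ℕ} (G : CGraph ar) : Prop :=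
  ∀ e₁ e₂ : G.E, G.lab e₁ = G.lab e₂ → G.edg e₁ = G.edg e₂ → e₁ = e₂

/-- The set of labels extended by the binary disequality label is `Option 𝔸`,
where `none` is the disequality label. -/
def richArity {𝔸 : Type*} (ar : 𝔸 → ℕ) : Option 𝔸 → ℕ
  | none => 2
  | some a => ar a

/-- Deletion of all the edges having the disequality label. -/
def CGraph.proj {𝔸 : Type*} {ar : 𝔸 → ℕ} (G : CGraph (richArity ar)) : CGraph ar where
  V := G.V
  E := {e : G.E // (G.lab e).isSome}
  finV := G.finV
  finE := inferInstance
  lab e := (G.lab e.1).get e.2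
  edg e := G.edg e.1
  edg_length e := by
    have h : G.lab e.1 = some ((G.lab e.1).get e.2) := (Option.some_get e.2).symm
    rw [G.edg_length e.1]
    exact congrArg (richArity ar) h

/-! ### Tree-width -/

/-- A tree decomposition: a finite tree whose nodes carry bags of vertices, such that the vertices
attached to each edge are together in some bag, and the nodes whose bags hold a given vertex form
a non-empty connected subset of the tree. -/
structure TreeDecomposition {L : Type*} {ar : L → ℕ} (G : CGraph ar) where
  N : Type
  finN : Finite N
  tree : SimpleGraph N
  isTree : tree.IsTree
  bag : N → Finset G.V
  edge_mem : ∀ e : G.E, ∃ n, ∀ v ∈ G.edg e, v ∈ bag n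
  connected : ∀ v : G.V, (tree.induce {n | v ∈ bag n}).Connected

/-- The maximal size of a bag, minus one (and zero if all bags are empty). -/
noncomputable def TreeDecomposition.width {L : Type*} {ar : L → ℕ} {G : CGraph ar}
    (D : TreeDecomposition G) : ℕ∞ :=
  ⨆ n : D.N, (((D.bag n).card - 1 : ℕ) : ℕ∞)

/-- The tree-width of a c-graph. -/
noncomputable def CGraph.tw {L : Type*} {ar : L → ℕ} (G : CGraph ar) : ℕ∞ :=
  ⨅ D : TreeDecomposition G, D.width

/-- The tree-width of a set of c-graphs (infinite if unbounded). -/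
noncomputable def setTw {L : Type*} {ar : L → ℕ} (S : Set (CGraph ar)) : ℕ∞ :=
  ⨆ G ∈ S, G.tw

/-! ### Quotients and fusion bounds -/

/-- The quotient of a c-graph by an equivalence relation on its vertices. -/
def CGraph.quotient {L : Type*} {ar : L → ℕ} (G : CGraph ar) (r : Setoid G.V) : CGraph ar where
  V := Quotient r
  E := G.E
  finV := inferInstance
  finE := G.finE
  lab := G.lab
  edg e := (G.edg e).map (Quotient.mk r)
  edg_length e := by rw [List.length_map, G.edg_length]

/-- An equivalence relation is compatible if it neither makes parallel two distinct equally
labelled edges, the disequality edges excepted, nor relates the endpoints of a disequality edge. -/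
structure CGraph.Compatible {𝔸 : Type*} {ar : 𝔸 → ℕ} (G : CGraph (richArity ar))
    (r : Setoid G.V) : Prop where
  edges : ∀ e₁ e₂ : G.E, e₁ ≠ e₂ → G.lab e₁ = G.lab e₂ → G.lab e₁ ≠ none →
    ¬ List.Forall₂ (fun u v => r u v) (G.edg e₁) (G.edg e₂)
  diseq : ∀ (e : G.E) (v₁ v₂ : G.V), G.lab e = none → G.edg e = [v₁, v₂] → ¬ r v₁ v₂

/-- `r` is the least equivalence relation containing the pairs in `S`. -/
def GeneratedBy {V : Type*} (r : Setoid V) (S : Finset (V × V)) : Prop :=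
  IsLeast {t : Setoid V | ∀ p ∈ S, t p.1 p.2} r

/-- `k` is the minimal cardinality of a set of pairs that generates `r`. -/
def IsKGenerated {V : Type*} (r : Setoid V) (k : ℕ) : Prop :=
  IsLeast {n : ℕ | ∃ S : Finset (V × V), S.card = n ∧ GeneratedBy r S} k

/-- The fusion bound of a c-graph: the maximal `k` such that some equivalence relation that is
compatible with `G` is `k`-generated. -/
noncomputable def CGraph.fb {𝔸 : Type*} {ar : 𝔸 → ℕ} (G : CGraph (richArity ar)) : ℕ∞ :=
  ⨆ (k : ℕ) (_ : ∃ r : Setoid G.V, G.Compatible r ∧ IsKGenerated r k), (k : ℕ∞)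

/-- The fusion bound of a set of c-graphs (infinite if unbounded). -/
noncomputable def setFb {𝔸 : Type*} {ar : 𝔸 → ℕ} (S : Set (CGraph (richArity ar))) : ℕ∞ :=
  ⨆ G ∈ S, G.fb

/-! ### Formulas and systems of inductive definitions -/

/-- Equality, disequality and relation atoms with variables in `X`. -/
inductive Atom {𝔸 : Type*} (ar : 𝔸 → ℕ) (X : Type)
  | eq (x y : X)
  | ne (x y : X)
  | rel (a : 𝔸) (xs : Fin (ar a) → X)

/-- Substitution of variables in an atom. -/
def Atom.map {𝔸 : Type*} {ar : 𝔸 → ℕ} {X Y : Type} (f : X → Y) : Atom ar X → Atom ar Y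
  | .eq x y => .eq (f x) (f y)
  | .ne x y => .ne (f x) (f y)
  | .rel a xs => .rel a (fun i => f (xs i))

/-- A quantifier- and predicate-free formula: the separating conjunction of a list of atoms, where
the empty list is `emp`. -/
abbrev QPF {𝔸 : Type*} (ar : 𝔸 → ℕ) (X : Type) := List (Atom ar X)

/-- A rule `B₀(x₁, …, xₙ) ← ∃ y₁ … ∃ yₘ . ψ * B₁(z₁) * … * Bₖ(zₖ)`, where `ψ` is a quantifier- and
predicate-free formula.  The variable `xᵢ` is `Sum.inl i` and `yⱼ` is `Sum.inr j`. -/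
structure Rule {𝔸 : Type*} (ar : 𝔸 → ℕ) {ℙ : Type*} (par : ℙ → ℕ) where
  head : ℙ
  ex : ℕ
  body : QPF ar (Fin (par head) ⊕ Fin ex)
  k : ℕ
  callee : Fin k → ℙ
  actual : (i : Fin k) → Fin (par (callee i)) → Fin (par head) ⊕ Fin ex

section semantics

variable {𝔸 : Type*} {ar : 𝔸 → ℕ} {ℙ : Type*} {par : ℙ → ℕ}

/-- The part of `G` that has the edges `F` satisfies the atom under the store `s`. -/
def AtomSat (G : CGraph ar) {X : Type} (s : X → G.V) (F : Set G.E) : Atom ar X → Prop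
  | .eq x y => F = ∅ ∧ s x = s y
  | .ne x y => F = ∅ ∧ s x ≠ s y
  | .rel a xs => ∃ e, F = {e} ∧ G.lab e = a ∧ G.edg e = List.ofFn (fun i => s (xs i))

/-- The part of `G` that has the edges `F` satisfies the separating conjunction of the atoms:
`F` splits into disjoint parts that satisfy the atoms. -/
def QSat (G : CGraph ar) {X : Type} (s : X → G.V) (F : Set G.E) : QPF ar X → Prop
  | [] => F = ∅
  | a :: φ => ∃ F₁ F₂, F = F₁ ∪ F₂ ∧ Disjoint F₁ F₂ ∧ AtomSat G s F₁ a ∧ QSat G s F₂ φ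

/-- The simple c-graph `G` is a model of `φ` under the store `s` of the variables in `X`, whose
values are all the vertices of `G`. -/
def Models (G : CGraph ar) {X : Type} (s : X → G.V) (φ : QPF ar X) : Prop :=
  G.Simple ∧ Function.Surjective s ∧ QSat G s Set.univ φ

/-- The predicate atoms' semantics: the sub-c-graph of `G` that has the vertices `W` and the edges
`F` satisfies `P(args)`.  This is the least relation such that `P(args)` holds if the right-hand
side of some rule for `P` holds for some values of its existential variables, where the edges are
split by the separating conjunction into disjoint parts, and vertices may be shared.  The vertices
are exactly the values of the variables. -/
inductive PredSat (Δ : Set (Rule ar par)) (G : CGraph ar) :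
    (P : ℙ) → (Fin (par P) → G.V) → Set G.V → Set G.E → Prop
  | unfold (ρ : Rule ar par) (hρ : ρ ∈ Δ) (args : Fin (par ρ.head) → G.V) (ys : Fin ρ.ex → G.V)
      (F₀ : Set G.E) (W : Fin ρ.k → Set G.V) (F : Fin ρ.k → Set G.E)
      (hbody : QSat G (Sum.elim args ys) F₀ ρ.body)
      (hcalls : ∀ i, PredSat Δ G (ρ.callee i)
        (fun j => Sum.elim args ys (ρ.actual i j)) (W i) (F i))
      (hdisj₀ : ∀ i, Disjoint F₀ (F i))
      (hdisj : ∀ i j, i ≠ j → Disjoint (F i) (F j)) :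
      PredSat Δ G ρ.head args (Set.range args ∪ Set.range ys ∪ ⋃ i, W i) (F₀ ∪ ⋃ i, F i)

/-- The `Δ`-models of `A` (for a nullary `A`, the tuple `args` is empty). -/
def sidSem (Δ : Set (Rule ar par)) (A : ℙ) : Set (CGraph ar) :=
  {G | G.Simple ∧ ∃ args : Fin (par A) → G.V, PredSat Δ G A args Set.univ Set.univ}

/-! ### Parse trees and canonical models -/

/-- Parse trees: the unfoldings of a predicate by the rules of `Δ`. -/
inductive ParseTree (Δ : Set (Rule ar par)) : ℙ → Type _
  | node (ρ : Rule ar par) (hρ : ρ ∈ Δ) (children : (i : Fin ρ.k) → ParseTree Δ (ρ.callee i)) :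
      ParseTree Δ ρ.head

/-- The existentially quantified variables of the unfolding: one copy of the existential variables
of a rule for each node of the tree labelled by that rule. -/
def ParseTree.Bound {Δ : Set (Rule ar par)} : {P : ℙ} → ParseTree Δ P → Type
  | _, .node ρ _ ch => Fin ρ.ex ⊕ (Σ i : Fin ρ.k, (ch i).Bound)

/-- The separating conjunction of all atoms of the unfolding, where the parameters of the root
predicate are replaced by `p` and the existential variables are named by `b`. -/
def ParseTree.unfolding {Δ : Set (Rule ar par)} : {P : ℙ} → (T : ParseTree Δ P) → {X : Type} →
    (p : Fin (par P) → X) → (b : T.Bound → X) → QPF ar X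
  | _, .node ρ _ ch, _, p, b =>
    ρ.body.map (Atom.map (Sum.elim p (fun y => b (Sum.inl y)))) ++
      (List.ofFn fun i : Fin ρ.k =>
        (ch i).unfolding (fun j => Sum.elim p (fun y => b (Sum.inl y)) (ρ.actual i j))
          (fun y => b (Sum.inr ⟨i, y⟩))).flatten

/-- The variables of the characteristic formula (for a nullary predicate, only the second summand
is inhabited). -/
abbrev ParseTree.Var {Δ : Set (Rule ar par)} {P : ℙ} (T : ParseTree Δ P) : Type :=
  Fin (par P) ⊕ T.Bound

/-- The characteristic formula of a parse tree. -/
def ParseTree.charForm {Δ : Set (Rule ar par)} {P : ℙ} (T : ParseTree Δ P) : QPF ar T.Var :=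
  T.unfolding Sum.inl Sum.inr

/-- `x = y` is a logical consequence of `φ`. -/
def EntailsEq {X : Type} (φ : QPF ar X) (x y : X) : Prop :=
  ∀ (G : CGraph ar) (s : X → G.V), Models G s φ → s x = s y

/-- The store `s` is canonical for `φ`: it identifies only variables whose equality is a logical
consequence of `φ`. -/
def CanonicalStore {X V : Type} (φ : QPF ar X) (s : X → V) : Prop :=
  ∀ x y, s x = s y → EntailsEq φ x y

/-- The rich canonical `Δ`-models of `A`. -/
def rcSem (Δ : Set (Rule ar par)) (A : ℙ) : Set (CGraph (richArity ar)) :=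
  {G | G.Simple ∧ ∃ (T : ParseTree Δ A) (s : T.Var → G.V),
    CanonicalStore T.charForm s ∧ Models G.proj s T.charForm ∧
    ∀ u v : G.V, (∃ e : G.E, G.lab e = none ∧ G.edg e = [u, v]) ↔
      ∃ x y : T.Var, s x = u ∧ s y = v ∧ Atom.ne x y ∈ T.charForm}

end semantics

end SLR

open SLR

/-!
Add to every bag of a tree decomposition of `G` one vertex for each pair of a generating set of an
equivalence relation on the vertices. The classes that meet no generating pair are singletons, whose
nodes are those of their only element, and the other classes are now in every bag; so fusing the
vertices along a relation generated by `k` pairs raises the tree-width by at most `k`.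

A model of a predicate is a model of the characteristic formula `Θ(T)` of a parse tree `T`.
The classes of variables whose equality follows from `Θ(T)`, with one edge for each relation atom
and one disequality edge for each disequality atom between classes, form a rich canonical model.
Since a store of a model of `Θ(T)` is constant on these classes, it fuses the rich canonical
model into the given one, and it does so compatibly because the given model is simple and satisfies
the disequalities. The fusion bound counts the pairs that generate this fusion.
-/

open scoped Function

namespace SLR

section Fusion

variable {L L' : Type*} {ar : L → ℕ} {ar' : L' → ℕ}
  {G : CGraph ar} {H : CGraph ar'} {f : G.V → H.V}

/-- `f` fuses vertices of `G` into the vertices of `H`, and all edges of `H` stem from edges of `G`.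
Edges of `G` may get lost and labels may change, since neither raises the tree-width. -/
structure CGraph.IsFusion (G : CGraph ar) (H : CGraph ar') (f : G.V → H.V) : Prop where
  surjective : Function.Surjective f
  exists_edg_eq_map : ∀ e : H.E, ∃ e' : G.E, H.edg e = (G.edg e').map f

lemma CGraph.isFusion_quotient_mk (G : CGraph ar) (r : Setoid G.V) :
    G.IsFusion (G.quotient r) (Quotient.mk r) :=
  ⟨Quotient.mk_surjective, fun e => ⟨e, rfl⟩⟩

open Classical in
/-- The image of a tree decomposition under a fusion `f`, with the vertices in `C` added to every
bag. The set `C` makes up for the failure of `f` to be injective: the bags that hold a vertex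
outside `C` are those that hold its only preimage. -/
noncomputable def TreeDecomposition.fuse (D : TreeDecomposition G) (hf : G.IsFusion H f)
    (C : Finset H.V) (hC : Set.InjOn f {u | f u ∉ C}) : TreeDecomposition H where
  N := D.N
  finN := D.finN
  tree := D.tree
  isTree := D.isTree
  bag n := (D.bag n).image f ∪ C
  edge_mem e := by
    obtain ⟨e', he⟩ := hf.exists_edg_eq_map e
    obtain ⟨n, hn⟩ := D.edge_mem e'
    refine ⟨n, fun v hv => Finset.mem_union_left _ ?_⟩
    obtain ⟨u, hu, rfl⟩ := List.mem_map.mp (he ▸ hv)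
    exact Finset.mem_image_of_mem f (hn u hu)
  connected v := by
    by_cases hv : v ∈ C
    · have h_nodes : {n | v ∈ (D.bag n).image f ∪ C} = Set.univ :=
        Set.eq_univ_of_forall fun n => Finset.mem_union_right _ hv
      rw [h_nodes]
      exact (SimpleGraph.induceUnivIso D.tree).connected_iff.mpr D.isTree.connected
    · obtain ⟨u, rfl⟩ := hf.surjective v
      have h_nodes : {n | f u ∈ (D.bag n).image f ∪ C} = {n | u ∈ D.bag n} := by
        ext n
        simp only [Set.mem_ofPred_eq, Finset.mem_union, Finset.mem_image, hv, or_false]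
        refine ⟨?_, fun hu => ⟨u, hu, rfl⟩⟩
        rintro ⟨u', hu', h_eq⟩
        exact hC (h_eq ▸ hv : f u' ∉ C) hv h_eq ▸ hu'
      rw [h_nodes]
      exact D.connected u

lemma TreeDecomposition.width_fuse_le (D : TreeDecomposition G) (hf : G.IsFusion H f)
    (C : Finset H.V) (hC : Set.InjOn f {u | f u ∉ C}) :
    (D.fuse hf C hC).width ≤ D.width + (C.card : ℕ∞) := by
  classical
  refine iSup_le fun n => ?_
  have h_card : ((D.fuse hf C hC).bag n).card ≤ (D.bag n).card + C.card :=
    (Finset.card_union_le _ _).trans (by gcongr; exact Finset.card_image_le)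
  calc ((((D.fuse hf C hC).bag n).card - 1 : ℕ) : ℕ∞)
      ≤ (((D.bag n).card - 1 + C.card : ℕ) : ℕ∞) := by gcongr; omega
    _ = (((D.bag n).card - 1 : ℕ) : ℕ∞) + C.card := Nat.cast_add _ _
    _ ≤ D.width + C.card := by
        gcongr
        exact le_iSup (fun n : D.N => (((D.bag n).card - 1 : ℕ) : ℕ∞)) n

lemma CGraph.IsFusion.tw_le_add_card (hf : G.IsFusion H f) (C : Finset H.V)
    (hC : Set.InjOn f {u | f u ∉ C}) : H.tw ≤ G.tw + (C.card : ℕ∞) := by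
  simp only [CGraph.tw, ENat.iInf_add]
  exact le_iInf fun D => (iInf_le _ (D.fuse hf C hC)).trans (D.width_fuse_le hf C hC)

lemma GeneratedBy.injOn {V W : Type*} {f : V → W} {S : Finset (V × V)}
    (hS : GeneratedBy (Setoid.ker f) S) : Set.InjOn f {u | ∀ p ∈ S, f p.1 ≠ f u} := by
  classical
  intro x hx y _ hxy
  -- The fibre of `x` is discrete for this relation, and all other vertices are equivalent.
  let t : Setoid V := Setoid.ker fun u => if f u = f x then some u else none
  have h_pairs : ∀ p ∈ S, t p.1 p.2 := fun p hp => by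
    have h_eq : f p.1 = f p.2 := hS.1 p hp
    simp [t, Setoid.ker_def, hx p hp, h_eq ▸ hx p hp]
  have h_some : (if f x = f x then some x else none) = if f y = f x then some y else none :=
    hS.2 h_pairs hxy
  simpa [hxy] using h_some

theorem CGraph.IsFusion.tw_le (hf : G.IsFusion H f) {S : Finset (G.V × G.V)}
    (hS : GeneratedBy (Setoid.ker f) S) : H.tw ≤ G.tw + (S.card : ℕ∞) := by
  classical
  let C : Finset H.V := S.image fun p => f p.1
  have hC : Set.InjOn f {u | f u ∉ C} := hS.injOn.mono fun u hu p hp h_eq =>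
    hu (Finset.mem_image.mpr ⟨p, hp, h_eq⟩)
  calc H.tw ≤ G.tw + C.card := hf.tw_le_add_card C hC
    _ ≤ G.tw + S.card := by gcongr; exact Finset.card_image_le

theorem CGraph.tw_quotient_le (G : CGraph ar) {r : Setoid G.V} {S : Finset (G.V × G.V)}
    (hS : GeneratedBy r S) : (G.quotient r).tw ≤ G.tw + (S.card : ℕ∞) := by
  rw [← Setoid.ker_mk_eq r] at hS
  exact (G.isFusion_quotient_mk r).tw_le hS

lemma exists_isKGenerated {V : Type*} [Finite V] (r : Setoid V) : ∃ k, IsKGenerated r k := by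
  let pairs : Set (V × V) := {p | r p.1 p.2}
  have h_gen : GeneratedBy r pairs.toFinite.toFinset :=
    ⟨fun p hp => by simpa [pairs] using hp, fun t ht x y hxy => ht (x, y) (by simpa [pairs])⟩
  exact ⟨_, isLeast_csInf ⟨_, _, rfl, h_gen⟩⟩

lemma CGraph.Compatible.le_fb {𝔸 : Type*} {ar : 𝔸 → ℕ} {G : CGraph (richArity ar)}
    {r : Setoid G.V} (hr : G.Compatible r) {k : ℕ} (hk : IsKGenerated r k) : (k : ℕ∞) ≤ G.fb :=
  le_iSup₂_of_le k ⟨r, hr, hk⟩ le_rfl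

lemma CGraph.IsFusion.tw_le_add_fb {𝔸 : Type*} {ar : 𝔸 → ℕ} {G : CGraph (richArity ar)}
    {H : CGraph ar'} {f : G.V → H.V} (hf : G.IsFusion H f) (hr : G.Compatible (Setoid.ker f)) :
    H.tw ≤ G.tw + G.fb := by
  obtain ⟨k, hk⟩ := exists_isKGenerated (Setoid.ker f)
  obtain ⟨S, rfl, hS⟩ := hk.1
  calc H.tw ≤ G.tw + S.card := hf.tw_le hS
    _ ≤ G.tw + G.fb := by gcongr; exact hr.le_fb hk

end Fusion

section Satisfaction

variable {𝔸 : Type*} {ar : 𝔸 → ℕ} {X Y : Type} {G : CGraph ar} {s : X → G.V} {F : Set G.E} {a : 𝔸}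
  {xs : Fin (ar a) → X} {l : List (Σ a : 𝔸, Fin (ar a) → X)} {x y : X} {φ ψ : QPF ar X}

lemma atomSat_map (f : X → Y) (s : Y → G.V) (F : Set G.E) (a : Atom ar X) :
    AtomSat G s F (a.map f) ↔ AtomSat G (s ∘ f) F a := by
  cases a <;> rfl

lemma qSat_map (f : X → Y) (s : Y → G.V) (F : Set G.E) (φ : QPF ar X) :
    QSat G s F (φ.map (Atom.map f)) ↔ QSat G (s ∘ f) F φ := by
  induction φ generalizing F with
  | nil => rfl
  | cons a φ ih => simp only [List.map_cons, QSat, atomSat_map, ih]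

lemma QSat.append {F₁ F₂ : Set G.E} (hφ : QSat G s F₁ φ) (hψ : QSat G s F₂ ψ)
    (hF : Disjoint F₁ F₂) : QSat G s (F₁ ∪ F₂) (φ ++ ψ) := by
  induction φ generalizing F₁ with
  | nil =>
    obtain rfl : F₁ = ∅ := hφ
    simpa using hψ
  | cons a φ ih =>
    obtain ⟨A, B, rfl, hAB, hA, hB⟩ := hφ
    rw [Set.disjoint_union_left] at hF
    exact ⟨A, B ∪ F₂, Set.union_assoc _ _ _, Set.disjoint_union_right.mpr ⟨hAB, hF.1⟩, hA,
      ih hB hF.2⟩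

lemma QSat.flatten_ofFn {n : ℕ} {φ : Fin n → QPF ar X} {F : Fin n → Set G.E}
    (hφ : ∀ i, QSat G s (F i) (φ i)) (hF : Pairwise (Disjoint on F)) :
    QSat G s (⋃ i, F i) (List.ofFn φ).flatten := by
  induction n with
  | zero => simp [QSat]
  | succ n ih =>
    have h_tail : QSat G s (⋃ i : Fin n, F i.succ) (List.ofFn fun i => φ i.succ).flatten :=
      ih (fun i => hφ i.succ) fun i j hij => hF ((Fin.succ_injective n).ne hij)
    have h_union : (⋃ i, F i) = F 0 ∪ ⋃ i : Fin n, F i.succ := by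
      ext e
      simp [Fin.exists_fin_succ]
    rw [List.ofFn_succ, List.flatten_cons, h_union]
    exact (hφ 0).append h_tail <|
      Set.disjoint_iUnion_right.mpr fun i => hF (Fin.succ_ne_zero i).symm

/-- The relation atoms of a formula, as pairs of a label and a tuple of variables. -/
def relAtoms : QPF ar X → List (Σ a : 𝔸, Fin (ar a) → X)
  | [] => []
  | .eq _ _ :: φ => relAtoms φ
  | .ne _ _ :: φ => relAtoms φ
  | .rel a xs :: φ => ⟨a, xs⟩ :: relAtoms φ

/-- `ε` assigns to the relation atoms in the list `l` distinct edges with the required labels and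
vertices, whose set is `F`. -/
structure IsMatching (G : CGraph ar) (s : X → G.V) (F : Set G.E)
    (l : List (Σ a : 𝔸, Fin (ar a) → X)) (ε : Fin l.length → G.E) : Prop where
  injective : Function.Injective ε
  range_eq : Set.range ε = F
  lab_eq : ∀ i, G.lab (ε i) = l[i].1
  edg_eq : ∀ i, G.edg (ε i) = List.ofFn (s ∘ l[i].2)

lemma exists_isMatching_nil : (∃ ε, IsMatching G s F [] ε) ↔ F = ∅ := by
  constructor
  · rintro ⟨ε, hε⟩
    rw [← hε.range_eq]
    exact Set.range_eq_empty (ι := Fin 0) ε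
  · rintro rfl
    exact ⟨Fin.elim0, fun i => i.elim0, Set.range_eq_empty (ι := Fin 0) _, fun i => i.elim0,
      fun i => i.elim0⟩

lemma exists_isMatching_cons :
    (∃ ε, IsMatching G s F (⟨a, xs⟩ :: l) ε) ↔
      ∃ F₁ F₂, F = F₁ ∪ F₂ ∧ Disjoint F₁ F₂ ∧ AtomSat G s F₁ (.rel a xs) ∧
        ∃ ε, IsMatching G s F₂ l ε := by
  constructor
  · rintro ⟨ε, h_inj, rfl, h_lab, h_edg⟩
    refine ⟨{ε 0}, Set.range (Fin.tail ε), Fin.range_fin_succ ε, ?_,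
      ⟨ε 0, rfl, h_lab 0, h_edg 0⟩, Fin.tail ε, h_inj.comp (Fin.succ_injective _), rfl,
      fun i => h_lab i.succ, fun i => h_edg i.succ⟩
    rw [Set.disjoint_singleton_left]
    rintro ⟨i, hi⟩
    exact Fin.succ_ne_zero i (h_inj hi)
  · rintro ⟨_, _, rfl, h_disj, ⟨e, rfl, h_lab, h_edg⟩, ε, hε⟩
    obtain ⟨h_inj, rfl, h_lab', h_edg'⟩ := hε
    exact ⟨Fin.cons e ε, Fin.cons_injective_iff.mpr ⟨Set.disjoint_singleton_left.mp h_disj, h_inj⟩,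
      Fin.range_cons e ε, Fin.cases h_lab h_lab', Fin.cases h_edg h_edg'⟩

lemma qSat_eq_cons : QSat G s F (.eq x y :: φ) ↔ s x = s y ∧ QSat G s F φ := by
  simp [QSat, AtomSat, and_assoc]

lemma qSat_ne_cons : QSat G s F (.ne x y :: φ) ↔ s x ≠ s y ∧ QSat G s F φ := by
  simp [QSat, AtomSat, and_assoc]

lemma qSat_iff :
    QSat G s F φ ↔ (∀ x y, Atom.eq x y ∈ φ → s x = s y) ∧ (∀ x y, Atom.ne x y ∈ φ → s x ≠ s y) ∧
      ∃ ε, IsMatching G s F (relAtoms φ) ε := by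
  induction φ generalizing F with
  | nil =>
    simp only [QSat, relAtoms, exists_isMatching_nil, List.not_mem_nil, IsEmpty.forall_iff,
      implies_true, true_and]
  | cons a φ ih =>
    cases a with
    | eq x y =>
      rw [qSat_eq_cons, ih]
      simp [relAtoms, or_imp, forall_and, and_assoc]
    | ne x y =>
      rw [qSat_ne_cons, ih]
      simp [relAtoms, or_imp, forall_and, and_assoc, and_left_comm]
    | rel a xs =>
      simp only [QSat, relAtoms, exists_isMatching_cons, ih, List.mem_cons, reduceCtorEq, false_or]
      grind

lemma Models.eq_of_mem (h : Models G s φ) (hxy : Atom.eq x y ∈ φ) : s x = s y :=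
  (qSat_iff.mp h.2.2).1 x y hxy

lemma Models.ne_of_mem (h : Models G s φ) (hxy : Atom.ne x y ∈ φ) : s x ≠ s y :=
  (qSat_iff.mp h.2.2).2.1 x y hxy

end Satisfaction

section ParseTree

variable {𝔸 : Type*} {ar : 𝔸 → ℕ} {ℙ : Type*} {par : ℙ → ℕ} {Δ : Set (Rule ar par)} {P : ℙ}

instance ParseTree.finite_bound (T : ParseTree Δ P) : Finite T.Bound := by
  induction T with
  | node ρ _ children ih =>
    exact inferInstanceAs (Finite (Fin ρ.ex ⊕ Σ i, (children i).Bound))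

lemma Atom.map_map {X Y Z : Type} (f : X → Y) (g : Y → Z) (a : Atom ar X) :
    (a.map f).map g = a.map (g ∘ f) := by
  cases a <;> rfl

lemma ParseTree.map_unfolding {X Y : Type} (T : ParseTree Δ P) (f : X → Y) (p : Fin (par P) → X)
    (b : T.Bound → X) : (T.unfolding p b).map (Atom.map f) = T.unfolding (f ∘ p) (f ∘ b) := by
  induction T with
  | node ρ _ children ih =>
    have h_elim : ∀ x, f (Sum.elim p (fun y => b (Sum.inl y)) x) =
        Sum.elim (fun j => f (p j)) (fun y => f (b (Sum.inl y))) x := by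
      rintro (j | y) <;> rfl
    simp only [ParseTree.unfolding, List.map_append, List.map_map, List.map_flatten, List.map_ofFn,
      Function.comp_def, Atom.map_map, h_elim, ih]

lemma ParseTree.qSat_unfolding {G : CGraph ar} {T : ParseTree Δ P} {args : Fin (par P) → G.V}
    {b : T.Bound → G.V} {F : Set G.E} :
    QSat G id F (T.unfolding args b) ↔ QSat G (Sum.elim args b) F T.charForm := by
  have h_charForm : T.charForm.map (Atom.map (Sum.elim args b)) = T.unfolding args b :=
    T.map_unfolding ..
  rw [← h_charForm, qSat_map, Function.id_comp]

lemma PredSat.exists_parseTree {G : CGraph ar} {args : Fin (par P) → G.V} {W : Set G.V}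
    {F : Set G.E} (h : PredSat Δ G P args W F) :
    ∃ (T : ParseTree Δ P) (b : T.Bound → G.V),
      W = Set.range args ∪ Set.range b ∧ QSat G id F (T.unfolding args b) := by
  induction h with
  | unfold ρ hρ args ys F₀ W F h_body _ h_disj₀ h_disj ih =>
    choose children b hW h_children using ih
    let b' : Fin ρ.ex ⊕ (Σ i, (children i).Bound) → G.V := Sum.elim ys fun z => b z.1 z.2
    refine ⟨.node ρ hρ children, b', ?_, ?_⟩
    · have h_actual : ⋃ i, Set.range (fun j => Sum.elim args ys (ρ.actual i j)) ⊆
          Set.range args ∪ Set.range ys := by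
        rw [← Set.Sum.elim_range]
        exact Set.iUnion_subset fun i => Set.range_comp_subset_range (ρ.actual i) _
      have h_b' : Set.range b' = Set.range ys ∪ ⋃ i, Set.range (b i) := by
        ext v
        simp [b']
      calc Set.range args ∪ Set.range ys ∪ ⋃ i, W i
          = Set.range args ∪ Set.range ys ∪ ⋃ i, Set.range (b i) := by
            simp only [hW, Set.iUnion_union_distrib]
            rw [← Set.union_assoc, Set.union_eq_self_of_subset_right h_actual]
        _ = Set.range args ∪ Set.range b' := by rw [h_b', Set.union_assoc]
    · have h_root : QSat G id F₀ (ρ.body.map (Atom.map (Sum.elim args ys))) :=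
        (qSat_map ..).mpr h_body
      exact h_root.append (QSat.flatten_ofFn h_children h_disj)
        (Set.disjoint_iUnion_right.mpr h_disj₀)

lemma exists_models_charForm {G : CGraph ar} (hG : G ∈ sidSem Δ P) :
    ∃ (T : ParseTree Δ P) (s : T.Var → G.V), Models G s T.charForm := by
  obtain ⟨h_simple, args, h_sat⟩ := hG
  obtain ⟨T, b, h_verts, h_unfolding⟩ := h_sat.exists_parseTree
  refine ⟨T, Sum.elim args b, h_simple, ?_, ParseTree.qSat_unfolding.mp h_unfolding⟩
  rw [← Set.range_eq_univ, Set.Sum.elim_range, ← h_verts]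

end ParseTree

section RichModel

variable {𝔸 : Type*} {ar : 𝔸 → ℕ} {X : Type}

lemma CGraph.Simple.proj {H : CGraph (richArity ar)} (hH : H.Simple) : H.proj.Simple :=
  fun _ _ h_lab h_edg => Subtype.ext (hH _ _ (Option.get_inj.mp h_lab) h_edg)

lemma CGraph.Compatible.eq_of_edg_eq {H : CGraph (richArity ar)} {r : Setoid H.V}
    (hr : H.Compatible r) {e₁ e₂ : H.E} (h_lab : H.lab e₁ = H.lab e₂) (h_some : H.lab e₁ ≠ none)
    (h_edg : H.edg e₁ = H.edg e₂) : e₁ = e₂ := by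
  by_contra h_ne
  refine hr.edges e₁ e₂ h_ne h_lab h_some ?_
  rw [h_edg]
  exact List.forall₂_refl _

/-- The equivalence of variables whose equality is a logical consequence of `φ`. -/
def entailedSetoid (φ : QPF ar X) : Setoid X where
  r := EntailsEq φ
  iseqv :=
    { refl := fun _ _ _ _ => rfl
      symm := fun h G s hM => (h G s hM).symm
      trans := fun h h' G s hM => (h G s hM).trans (h' G s hM) }

/-- The pairs of classes of variables between which `φ` has a disequality atom. -/
abbrev DiseqPair (φ : QPF ar X) : Type :=
  {p : Quotient (entailedSetoid φ) × Quotient (entailedSetoid φ) //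
    ∃ x y, (⟦x⟧, ⟦y⟧) = p ∧ Atom.ne x y ∈ φ}

/-- The rich canonical model of `φ` built from its syntax: the vertices are the classes of variables
whose equality `φ` entails, with one edge for each relation atom and one disequality edge for each
pair of classes between which there is a disequality atom. -/
def richModel [Finite X] (φ : QPF ar X) : CGraph (richArity ar) where
  V := Quotient (entailedSetoid φ)
  E := Fin (relAtoms φ).length ⊕ DiseqPair φ
  finV := inferInstance
  finE := inferInstance
  lab := Sum.elim (fun i => some (relAtoms φ)[i].1) fun _ => none
  edg := Sum.elim (fun i => List.ofFn fun j => ⟦(relAtoms φ)[i].2 j⟧) fun p => [p.1.1, p.1.2]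
  edg_length := by
    rintro (i | p)
    · exact List.length_ofFn
    · rfl

/-- The store of `richModel φ` that maps each variable to its class. -/
def richStore [Finite X] (φ : QPF ar X) : X → (richModel φ).V :=
  Quotient.mk (entailedSetoid φ)

variable [Finite X] {φ : QPF ar X}

lemma canonicalStore_richStore : CanonicalStore φ (richStore φ) :=
  fun _ _ => Quotient.exact

lemma exists_diseq_edge_richModel_iff (u v : (richModel φ).V) :
    (∃ e, (richModel φ).lab e = none ∧ (richModel φ).edg e = [u, v]) ↔
      ∃ x y, richStore φ x = u ∧ richStore φ y = v ∧ Atom.ne x y ∈ φ := by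
  constructor
  · rintro ⟨i | ⟨_, x, y, rfl, hxy⟩, h_lab, h_edg⟩
    · cases h_lab
    · cases h_edg
      exact ⟨x, y, rfl, rfl, hxy⟩
  · rintro ⟨x, y, rfl, rfl, hxy⟩
    exact ⟨Sum.inr ⟨(⟦x⟧, ⟦y⟧), x, y, rfl, hxy⟩, rfl, rfl⟩

/-- The map that fuses the rich canonical model of `φ` into another model of `φ`. -/
def Models.fusion {G : CGraph ar} {s : X → G.V} (h : Models G s φ) : (richModel φ).V → G.V :=
  Quotient.lift s fun _ _ hxy => hxy G s h

variable {G : CGraph ar} {s : X → G.V}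

lemma Models.exists_edges (h : Models G s φ) :
    ∃ ε : Fin (relAtoms φ).length → G.E, Function.Bijective ε ∧
      (∀ i, some (G.lab (ε i)) = (richModel φ).lab (Sum.inl i)) ∧
      ∀ i, G.edg (ε i) = ((richModel φ).edg (Sum.inl i)).map h.fusion := by
  obtain ⟨-, -, ε, hε⟩ := qSat_iff.mp h.2.2
  exact ⟨ε, ⟨hε.injective, Set.range_eq_univ.mp hε.range_eq⟩,
    fun i => congrArg some (hε.lab_eq i), fun i => (hε.edg_eq i).trans
      (List.map_ofFn (f := richStore φ ∘ (relAtoms φ)[i].2) (g := h.fusion)).symm⟩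

lemma Models.isFusion (h : Models G s φ) : (richModel φ).IsFusion G h.fusion where
  surjective := Quotient.lift_surjective _ _ h.2.1
  exists_edg_eq_map e := by
    obtain ⟨ε, h_bij, -, h_edg⟩ := h.exists_edges
    obtain ⟨i, rfl⟩ := h_bij.surjective e
    exact ⟨Sum.inl i, h_edg i⟩

lemma Models.compatible_ker_fusion (h : Models G s φ) :
    (richModel φ).Compatible (Setoid.ker h.fusion) where
  edges := by
    obtain ⟨ε, h_bij, h_lab, h_edg⟩ := h.exists_edges
    rintro (i | p) (j | p') h_ne h_lab_eq h_some h_equiv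
    · have h_edg_eq : G.edg (ε i) = G.edg (ε j) := by
        rw [h_edg, h_edg, ← List.forall₂_eq_eq_eq, List.forall₂_map_left_iff,
          List.forall₂_map_right_iff]
        exact h_equiv
      have h_eq : ε i = ε j := h.1 _ _ (Option.some_injective _ (by rwa [h_lab, h_lab])) h_edg_eq
      exact h_ne (congrArg Sum.inl (h_bij.injective h_eq))
    · cases h_lab_eq
    · cases h_lab_eq
    · exact h_some rfl
  diseq e u v h_lab h_edg h_eq := by
    obtain ⟨x, y, rfl, rfl, hxy⟩ := (exists_diseq_edge_richModel_iff u v).mp ⟨e, h_lab, h_edg⟩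
    exact h.ne_of_mem hxy h_eq

lemma Models.simple_richModel (h : Models G s φ) : (richModel φ).Simple := by
  rintro (i | p) (j | p') h_lab h_edg
  · exact h.compatible_ker_fusion.eq_of_edg_eq h_lab (Option.some_ne_none _) h_edg
  · cases h_lab
  · cases h_lab
  · obtain ⟨⟨u, v⟩, hp⟩ := p
    obtain ⟨⟨u', v'⟩, hp'⟩ := p'
    cases h_edg
    rfl

lemma Models.proj_richModel (h : Models G s φ) : Models (richModel φ).proj (richStore φ) φ := by
  have h_eqs : ∀ x y, Atom.eq x y ∈ φ → richStore φ x = richStore φ y :=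
    fun x y hxy => Quotient.sound fun _ _ h' => h'.eq_of_mem hxy
  have h_nes : ∀ x y, Atom.ne x y ∈ φ → richStore φ x ≠ richStore φ y :=
    fun x y hxy h_eq => h.ne_of_mem hxy (congrArg h.fusion h_eq)
  have h_surj : Function.Surjective fun i => (⟨Sum.inl i, rfl⟩ : (richModel φ).proj.E) := by
    rintro ⟨i | p, h_some⟩
    · exact ⟨i, rfl⟩
    · cases h_some
  exact ⟨h.simple_richModel.proj, Quotient.mk_surjective, qSat_iff.mpr ⟨h_eqs, h_nes, _,
    fun i j h_eq => Sum.inl_injective (congrArg Subtype.val h_eq), Set.range_eq_univ.mpr h_surj,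
    fun _ => rfl, fun _ => rfl⟩⟩

end RichModel

lemma exists_fusion_of_mem_sidSem {𝔸 ℙ : Type*} {ar : 𝔸 → ℕ} {par : ℙ → ℕ}
    {Δ : Set (Rule ar par)} {P : ℙ} {G : CGraph ar} (hG : G ∈ sidSem Δ P) :
    ∃ H ∈ rcSem Δ P, ∃ f : H.V → G.V, H.IsFusion G f ∧ H.Compatible (Setoid.ker f) := by
  obtain ⟨T, s, h⟩ := exists_models_charForm hG
  exact ⟨richModel T.charForm,
    ⟨h.simple_richModel, T, richStore T.charForm, canonicalStore_richStore, h.proj_richModel,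
      exists_diseq_edge_richModel_iff⟩,
    h.fusion, h.isFusion, h.compatible_ker_fusion⟩

end SLR

theorem mainTheorem3_general {𝔸 L ℙ : Type*} (ar : 𝔸 → ℕ) (ar' : L → ℕ) (par : ℙ → ℕ)
    (Δ : Set (Rule ar par)) (P : ℙ) :
    setTw (sidSem Δ P) ≤ setTw (rcSem Δ P) + setFb (rcSem Δ P) ∧
    ∀ (G : CGraph ar') (r : Setoid G.V) (k : ℕ),
      IsKGenerated r k → (G.quotient r).tw ≤ G.tw + (k : ℕ∞) := by
  constructor
  · refine iSup₂_le fun G hG => ?_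
    obtain ⟨H, hH, f, hf, h_compat⟩ := exists_fusion_of_mem_sidSem hG
    calc G.tw ≤ H.tw + H.fb := hf.tw_le_add_fb h_compat
      _ ≤ setTw (rcSem Δ P) + setFb (rcSem Δ P) :=
        add_le_add (le_iSup₂_of_le H hH le_rfl) (le_iSup₂_of_le H hH le_rfl)
  · rintro G r _ ⟨⟨S, rfl, hS⟩, -⟩
    exact G.tw_quotient_le hS

theorem mainTheorem3 {𝔸 : Type*} (ar : 𝔸 → ℕ) {ℙ : Type*} (par : ℙ → ℕ)
    (Δ : Set (Rule ar par)) (A : ℙ) (hA : par A = 0) :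
    setTw (sidSem Δ A) ≤ setTw (rcSem Δ A) + setFb (rcSem Δ A) ∧
    ∀ (G : CGraph (richArity ar)) (r : Setoid G.V) (k : ℕ),
      G.Compatible r → IsKGenerated r k → (G.quotient r).tw ≤ G.tw + (k : ℕ∞) := by
  have h := mainTheorem3_general ar (richArity ar) par Δ A
  exact ⟨h.1, fun G r k _ hk => h.2 G r k hk⟩
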